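/- Let $m_1,m_2\ge 1$ and $1\le r\le n$ be integers, $A\in\mathbb R^{m_1\times n}$, $B\in\mathbb R^{m_2\times n}$, and let $\mathbb O^{n\times r}=\{U\in\mathbb R^{n\times r}: U^TU=I_r\}$. For a data matrix $D\in\mathbb R^{p\times n}$ put $$H_D=\frac1p\Big(\Big[\frac1r\sum_{i=1}^r\sigma_i(D)^2\Big]I_n-D^TD\Big),$$ where $\sigma_i(D)$ is the $i$-th largest singular value of $D$ (zero for $i>\min\{p,n\}$). Let $$\mathcal W_r(H_A,H_B)=\{y(U): U\in\mathbb O^{n\times r}\},\qquad y(U)=\big(\operatorname{Tr}(U^TH_AU),\operatorname{Tr}(U^TH_BU)\big)\in\mathbb R^2,$$ and for $t\in[0,1]$ let $H(t)=tH_A+(1-t)H_B$ and $\phi(t)=\sum_{i=1}^r\lambda_i(H(t))$, where $\lambda_1(H(t))\le\dots\le\lambda_n(H(t))$ are the eigenvalues of $H(t)$ with multiplicity. Then: 1. Both optima below are attained, and $$\min_{y\in\mathcal W_r(H_A,H_B)}\max\{y_1,y_2\}=\max_{t\in[0,1]}\phi(t).$$ 2. Let $y_*$ be any optimal solution of the minimization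 problem on the left and $t_*\in[0,1]$ any maximizer of $\phi$. Then $y_*=y(U_*)$ for some $U_*\in\mathbb O^{n\times r}$ whose $i$-th column is an eigenvector of $H(t_*)$ for $\lambda_i(H(t_*))$, $i=1,\dots,r$. Moreover, every $U\in\mathbb O^{n\times r}$ with $y(U)=y_*$ is an orthonormal basis matrix of an eigenspace for the $r$ smallest eigenvalues of $H(t_*)$, that is, its columns span the same subspace as some orthonormal eigenvectors for $\lambda_1(H(t_*)),\dots,\lambda_r(H(t_*))$. 3. If, in addition, $r=n$ or $\lambda_r(H(t_*))<\lambda_{r+1}(H(t_*))$, then $y_*=y(U)$ for every orthonormal basis matrix $U\in\mathbb O^{n\times r}$ of the eigenspace for the $r$ smallest eigenvalues of $H(t_*)$. -/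

import Mathlib

open Matrix Set

noncomputable section

namespace FairPCA

/-- The real `n × r` matrices with orthonormal columns. -/
def Stiefel (n r : ℕ) : Set (Matrix (Fin n) (Fin r) ℝ) :=
  {U | Uᵀ * U = 1}

/-- `σᵢ(D)`, the `i`-th largest singular value of `D`, counted from `i = 0`, with multiplicity;
it is zero beyond the number of rows or columns of `D`. -/
def singularValue {p n : ℕ} (D : Matrix (Fin p) (Fin n) ℝ) (i : ℕ) : ℝ :=
  (Matrix.toEuclideanLin D).singularValues i

/-- The matrix `H_D = (1/p) ([(1/r) ∑_{i ≤ r} σᵢ(D)²] Iₙ - Dᵀ D)` of a data matrix `D`. -/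
def lossMatrix {p n : ℕ} (r : ℕ) (D : Matrix (Fin p) (Fin n) ℝ) : Matrix (Fin n) (Fin n) ℝ :=
  (1 / (p : ℝ)) •
    (((1 / (r : ℝ)) * ∑ i ∈ Finset.range r, singularValue D i ^ 2) •
      (1 : Matrix (Fin n) (Fin n) ℝ) - Dᵀ * D)

/-- The pair `(Tr(Uᵀ S U), Tr(Uᵀ T U))`. -/
def tracePoint {n r : ℕ} (S T : Matrix (Fin n) (Fin n) ℝ) (U : Matrix (Fin n) (Fin r) ℝ) : ℝ × ℝ :=
  ((Uᵀ * S * U).trace, (Uᵀ * T * U).trace)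

/-- The `r`-th (real) joint numerical range of `S` and `T`. -/
def jointNumericalRange {n : ℕ} (r : ℕ) (S T : Matrix (Fin n) (Fin n) ℝ) : Set (ℝ × ℝ) :=
  tracePoint S T '' Stiefel n r

/-- The matrix `H(t) = t H_A + (1 - t) H_B`. -/
def pencil {m₁ m₂ n : ℕ} (r : ℕ) (A : Matrix (Fin m₁) (Fin n) ℝ) (B : Matrix (Fin m₂) (Fin n) ℝ)
    (t : ℝ) : Matrix (Fin n) (Fin n) ℝ :=
  t • lossMatrix r A + (1 - t) • lossMatrix r B

theorem lossMatrix_transpose {p n : ℕ} (r : ℕ) (D : Matrix (Fin p) (Fin n) ℝ) :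
    (lossMatrix r D)ᵀ = lossMatrix r D := by
  simp [lossMatrix, Matrix.transpose_sub, Matrix.transpose_smul, Matrix.transpose_mul]

theorem pencil_isHermitian {m₁ m₂ n : ℕ} (r : ℕ) (A : Matrix (Fin m₁) (Fin n) ℝ)
    (B : Matrix (Fin m₂) (Fin n) ℝ) (t : ℝ) : (pencil r A B t).IsHermitian := by
  rw [Matrix.IsHermitian, Matrix.conjTranspose_eq_transpose_of_trivial]
  simp [pencil, Matrix.transpose_add, Matrix.transpose_smul, lossMatrix_transpose]

/-- The eigenvalues of a real symmetric matrix in increasing order, with multiplicity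
(Mathlib's `eigenvalues₀` lists them in decreasing order). -/
def ascEigenvalue {n : ℕ} {S : Matrix (Fin n) (Fin n) ℝ} (hS : S.IsHermitian) (i : Fin n) : ℝ :=
  hS.eigenvalues₀ (Fin.cast (Fintype.card_fin n).symm i.rev)

/-- The function `φ(t) = ∑_{i ≤ r} λᵢ(H(t))`. -/
def phi {m₁ m₂ n r : ℕ} (hrn : r ≤ n) (A : Matrix (Fin m₁) (Fin n) ℝ)
    (B : Matrix (Fin m₂) (Fin n) ℝ) (t : ℝ) : ℝ :=
  ∑ i : Fin r, ascEigenvalue (pencil_isHermitian r A B t) (Fin.castLE hrn i)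

/-- The columns of `V` are orthonormal and the `i`-th one is an eigenvector of `S` for the `i`-th
smallest eigenvalue `λᵢ(S)`, `i ≤ r`. -/
def IsSmallestEigenvectors {n r : ℕ} (hrn : r ≤ n) {S : Matrix (Fin n) (Fin n) ℝ}
    (hS : S.IsHermitian) (V : Matrix (Fin n) (Fin r) ℝ) : Prop :=
  V ∈ Stiefel n r ∧
    S * V = V * Matrix.diagonal fun i : Fin r => ascEigenvalue hS (Fin.castLE hrn i)

/-- The columns of `U` are an orthonormal basis of an eigenspace for the `r` smallest eigenvalues
of `S`, that is, of the span of orthonormal eigenvectors for `λ₁(S), …, λᵣ(S)`. -/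
def IsSmallestEigenspaceBasis {n r : ℕ} (hrn : r ≤ n) {S : Matrix (Fin n) (Fin n) ℝ}
    (hS : S.IsHermitian) (U : Matrix (Fin n) (Fin r) ℝ) : Prop :=
  U ∈ Stiefel n r ∧ ∃ V : Matrix (Fin n) (Fin r) ℝ, IsSmallestEigenvectors hrn hS V ∧
    LinearMap.range U.mulVecLin = LinearMap.range V.mulVecLin

/-- `λᵣ(S) < λᵣ₊₁(S)`; no condition if `r = n`. -/
def HasGap {n : ℕ} (r : ℕ) {S : Matrix (Fin n) (Fin n) ℝ} (hS : S.IsHermitian) : Prop :=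
  ∀ h : r < n, ascEigenvalue hS ⟨r - 1, lt_of_le_of_lt (Nat.sub_le r 1) h⟩ <
    ascEigenvalue hS ⟨r, h⟩

/-- `y` is an optimal solution of `min max {y₁, y₂}` over the joint numerical range of
`H_A` and `H_B`. -/
def IsOptimal {m₁ m₂ n : ℕ} (r : ℕ) (A : Matrix (Fin m₁) (Fin n) ℝ)
    (B : Matrix (Fin m₂) (Fin n) ℝ) (y : ℝ × ℝ) : Prop :=
  y ∈ jointNumericalRange r (lossMatrix r A) (lossMatrix r B) ∧
    ∀ z ∈ jointNumericalRange r (lossMatrix r A) (lossMatrix r B), max y.1 y.2 ≤ max z.1 z.2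

end FairPCA

end

namespace FairPCA

theorem ascEigenvalue_monotone {n : ℕ} {S : Matrix (Fin n) (Fin n) ℝ} (hS : S.IsHermitian) :
    Monotone (ascEigenvalue hS) := by
  intro i j hij
  apply hS.eigenvalues₀_antitone
  simpa using hij

/-- The spectral theorem, with the eigenvalues in increasing order. -/
theorem exists_orthogonal_mul_eq {n : ℕ} {S : Matrix (Fin n) (Fin n) ℝ} (hS : S.IsHermitian) :
    ∃ W : Matrix (Fin n) (Fin n) ℝ, Wᵀ * W = 1 ∧ S * W = W * diagonal (ascEigenvalue hS) := by
  let e : Fin n ≃ Fin n := Fin.revPerm.trans ((finCongr (Fintype.card_fin n).symm).trans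
    (Fintype.equivOfCardEq (Fintype.card_fin _)))
  have he : ∀ i, hS.eigenvalues (e i) = ascEigenvalue hS i := by
    intro i
    simp [Matrix.IsHermitian.eigenvalues, e, ascEigenvalue]
  refine ⟨Matrix.of fun i j => hS.eigenvectorBasis (e j) i, ?_, ?_⟩
  · ext i j
    have h := orthonormal_iff_ite.1 hS.eigenvectorBasis.orthonormal (e i) (e j)
    simp only [EuclideanSpace.inner_eq_star_dotProduct, e.apply_eq_iff_eq] at h
    rw [Matrix.one_apply, ← h, Matrix.mul_apply, dotProduct]
    exact Finset.sum_congr rfl fun k _ => by simp [mul_comm]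
  · ext i j
    have h := congrFun (hS.mulVec_eigenvectorBasis (e j)) i
    rw [Matrix.mul_diagonal, ← he j, mul_comm]
    exact h

theorem sum_castLE_eq {r n : ℕ} (hrn : r ≤ n) (f : Fin n → ℝ) :
    ∑ i : Fin r, f (Fin.castLE hrn i) = ∑ j : Fin n, if (j : ℕ) < r then f j else 0 := by
  obtain ⟨k, rfl⟩ := Nat.exists_eq_add_of_le hrn
  rw [Fin.sum_univ_add]
  have : ∀ i : Fin k, ¬ ((Fin.natAdd r i : Fin (r + k)) : ℕ) < r := by intro i; simp
  simp only [this, if_false, Finset.sum_const_zero, add_zero]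
  refine Finset.sum_congr rfl fun i _ => ?_
  simp [Fin.castAdd]

theorem trace_transpose_mul_mul_mul {m n k : ℕ} (U : Matrix (Fin n) (Fin m) ℝ)
    (R : Matrix (Fin m) (Fin k) ℝ) (S : Matrix (Fin n) (Fin n) ℝ) :
    ((U * R)ᵀ * S * (U * R)).trace = ((R * Rᵀ) * (Uᵀ * S * U)).trace := by
  rw [← Matrix.mul_assoc, Matrix.trace_mul_comm, Matrix.transpose_mul]
  simp only [Matrix.mul_assoc]

theorem trace_of_mul_orthogonal {n r : ℕ} (U : Matrix (Fin n) (Fin r) ℝ)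
    {R : Matrix (Fin r) (Fin r) ℝ} (hR : Rᵀ * R = 1) (S : Matrix (Fin n) (Fin n) ℝ) :
    ((U * R)ᵀ * S * (U * R)).trace = (Uᵀ * S * U).trace := by
  rw [trace_transpose_mul_mul_mul, mul_eq_one_comm.1 hR, Matrix.one_mul]

theorem mul_mem_stiefel {n r k : ℕ} {U : Matrix (Fin n) (Fin r) ℝ} (hU : U ∈ Stiefel n r)
    {R : Matrix (Fin r) (Fin k) ℝ} (hR : Rᵀ * R = 1) : U * R ∈ Stiefel n k := by
  change (U * R)ᵀ * (U * R) = 1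
  have hU' : Uᵀ * U = 1 := hU
  rw [Matrix.transpose_mul, Matrix.mul_assoc, ← Matrix.mul_assoc Uᵀ, hU', Matrix.one_mul, hR]

theorem col_sum_sq {n r : ℕ} {X : Matrix (Fin n) (Fin r) ℝ} (hX : Xᵀ * X = 1) (l : Fin r) :
    ∑ j, X j l ^ 2 = 1 := by
  have := congrFun (congrFun hX l) l
  simp only [Matrix.mul_apply, Matrix.transpose_apply, Matrix.one_apply_eq] at this
  simpa [sq] using this

theorem proj_diag_eq {n r : ℕ} {X : Matrix (Fin n) (Fin r) ℝ} (hX : Xᵀ * X = 1) (j : Fin n) :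
    (X * Xᵀ) j j = ∑ k, (X * Xᵀ) j k ^ 2 := by
  have h : (X * Xᵀ) * (X * Xᵀ)ᵀ = X * Xᵀ := by
    rw [Matrix.transpose_mul, Matrix.transpose_transpose, Matrix.mul_assoc, ← Matrix.mul_assoc Xᵀ,
      hX, Matrix.one_mul]
  conv_lhs => rw [← h]
  rw [Matrix.mul_apply]
  exact Finset.sum_congr rfl fun k _ => by rw [Matrix.transpose_apply, sq]

theorem proj_diag_nonneg {n r : ℕ} {X : Matrix (Fin n) (Fin r) ℝ} (hX : Xᵀ * X = 1) (j : Fin n) :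
    0 ≤ (X * Xᵀ) j j := by
  rw [proj_diag_eq hX]; positivity

theorem sq_le_proj_diag {n r : ℕ} {X : Matrix (Fin n) (Fin r) ℝ} (hX : Xᵀ * X = 1) (j k : Fin n) :
    (X * Xᵀ) j k ^ 2 ≤ (X * Xᵀ) j j := by
  rw [proj_diag_eq hX j]
  exact Finset.single_le_sum (f := fun k => (X * Xᵀ) j k ^ 2) (fun _ _ => sq_nonneg _)
    (Finset.mem_univ k)

theorem proj_diag_le_one {n r : ℕ} {X : Matrix (Fin n) (Fin r) ℝ} (hX : Xᵀ * X = 1) (j : Fin n) :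
    (X * Xᵀ) j j ≤ 1 := by
  nlinarith [sq_le_proj_diag hX j j]

/-- A diagonal entry of an orthogonal projection that is `0` or `1` is alone in its row. -/
theorem proj_apply_eq_zero {n r : ℕ} {X : Matrix (Fin n) (Fin r) ℝ} (hX : Xᵀ * X = 1)
    {j k : Fin n} (hj : (X * Xᵀ) j j = 0 ∨ (X * Xᵀ) j j = 1) (hjk : j ≠ k) :
    (X * Xᵀ) j k = 0 := by
  have h := Finset.add_le_sum (s := Finset.univ) (f := fun k => (X * Xᵀ) j k ^ 2)
    (fun _ _ => sq_nonneg _) (Finset.mem_univ j) (Finset.mem_univ k) hjk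
  rw [← proj_diag_eq hX j] at h
  have : (X * Xᵀ) j k ^ 2 = 0 := by
    refine le_antisymm ?_ (sq_nonneg _)
    rcases hj with hj | hj <;> simp only [hj] at h <;> linarith
  simpa using this

theorem diagonal_mul_apply_eq {n r : ℕ} {S : Matrix (Fin n) (Fin n) ℝ} {W : Matrix (Fin n) (Fin n) ℝ}
    {a : Fin n → ℝ} (hSW : S * W = W * diagonal a) (hS : Sᵀ = S)
    {V : Matrix (Fin n) (Fin r) ℝ} {b : Fin r → ℝ} (hV : S * V = V * diagonal b)
    (j : Fin n) (l : Fin r) : a j * (Wᵀ * V) j l = (Wᵀ * V) j l * b l := by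
  have h1 : diagonal a * (Wᵀ * V) = (Wᵀ * V) * diagonal b := by
    have h2 : Wᵀ * S = diagonal a * Wᵀ := by
      have := congrArg Matrix.transpose hSW
      rwa [Matrix.transpose_mul, Matrix.transpose_mul, hS, Matrix.diagonal_transpose] at this
    rw [← Matrix.mul_assoc, ← h2, Matrix.mul_assoc, hV, Matrix.mul_assoc]
  have := congrFun (congrFun h1 j) l
  rwa [Matrix.diagonal_mul, Matrix.mul_diagonal] at this

theorem transpose_mul_stiefel {n r : ℕ} {W : Matrix (Fin n) (Fin n) ℝ} (hW : Wᵀ * W = 1)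
    {V : Matrix (Fin n) (Fin r) ℝ} (hV : V ∈ Stiefel n r) : (Wᵀ * V)ᵀ * (Wᵀ * V) = 1 := by
  have hV' : Vᵀ * V = 1 := hV
  rw [Matrix.transpose_mul, Matrix.transpose_transpose, Matrix.mul_assoc, ← Matrix.mul_assoc W,
    mul_eq_one_comm.1 hW, Matrix.one_mul, hV']

/-- An orthonormal frame of `i + 1` vectors cannot lie in the span of `i` orthonormal vectors. -/
theorem not_forall_apply_eq_zero {n r : ℕ} (hrn : r ≤ n) {X : Matrix (Fin n) (Fin r) ℝ}
    (hX : Xᵀ * X = 1) (i : Fin r) :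
    ¬ ∀ (j : Fin n) (l : Fin r), (i : ℕ) ≤ j → l ≤ i → X j l = 0 := by
  intro h
  have h1 : ∑ l ∈ Finset.Iic i, ∑ j, X j l ^ 2 = (i : ℝ) + 1 := by
    rw [Finset.sum_congr rfl fun l _ => col_sum_sq hX l]
    simp
  have h2 : ∑ l ∈ Finset.Iic i, ∑ j, X j l ^ 2 ≤ ∑ j : Fin n, if (j : ℕ) < i then (1 : ℝ) else 0 := by
    rw [Finset.sum_comm]
    refine Finset.sum_le_sum fun j _ => ?_
    split_ifs with hj
    · calc ∑ l ∈ Finset.Iic i, X j l ^ 2 ≤ ∑ l, X j l ^ 2 :=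
            Finset.sum_le_sum_of_subset_of_nonneg (Finset.subset_univ _) fun _ _ _ => sq_nonneg _
        _ = (X * Xᵀ) j j := by
            rw [Matrix.mul_apply]
            exact Finset.sum_congr rfl fun k _ => by rw [Matrix.transpose_apply, sq]
        _ ≤ 1 := proj_diag_le_one hX j
    · refine (Finset.sum_eq_zero fun l hl => ?_).le
      rw [h j l (not_lt.1 hj) (Finset.mem_Iic.1 hl)]; simp
  have h3 := sum_castLE_eq (i.2.le.trans hrn) (fun _ => (1 : ℝ))
  rw [← h3] at h2
  simp at h2
  linarith

/-- Interlacing: increasing eigenvalues of an orthonormal frame of eigenvectors dominate the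
smallest eigenvalues. -/
theorem ascEigenvalue_le_of_mul_eq {n r : ℕ} (hrn : r ≤ n) {S : Matrix (Fin n) (Fin n) ℝ}
    (hS : S.IsHermitian) {V : Matrix (Fin n) (Fin r) ℝ} (hV : V ∈ Stiefel n r) {b : Fin r → ℝ}
    (hb : Monotone b) (hSV : S * V = V * diagonal b) (i : Fin r) :
    ascEigenvalue hS (Fin.castLE hrn i) ≤ b i := by
  obtain ⟨W, hW, hSW⟩ := exists_orthogonal_mul_eq hS
  by_contra! hlt
  refine not_forall_apply_eq_zero hrn (transpose_mul_stiefel hW hV) i fun j l hj hl => ?_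
  have h := diagonal_mul_apply_eq hSW (by simpa using hS.eq) hSV j l
  have h1 : ascEigenvalue hS (Fin.castLE hrn i) ≤ ascEigenvalue hS j :=
    ascEigenvalue_monotone hS (by simpa [Fin.le_def] using hj)
  have h2 := hb hl
  by_contra h0
  rw [mul_comm] at h
  have := mul_left_cancel₀ h0 h
  linarith

theorem trace_eq_sum_mul_proj {n r : ℕ} {S W : Matrix (Fin n) (Fin n) ℝ} {a : Fin n → ℝ}
    (hW : Wᵀ * W = 1) (hSW : S * W = W * diagonal a) (U : Matrix (Fin n) (Fin r) ℝ) :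
    (Uᵀ * S * U).trace = ∑ j, a j * ((Wᵀ * U) * (Wᵀ * U)ᵀ) j j := by
  have hS : S = W * diagonal a * Wᵀ := by
    rw [← hSW, Matrix.mul_assoc, mul_eq_one_comm.1 hW, Matrix.mul_one]
  have : (Uᵀ * S * U).trace = (diagonal a * ((Wᵀ * U) * (Wᵀ * U)ᵀ)).trace := by
    rw [← Matrix.mul_assoc (diagonal a), Matrix.trace_mul_comm (diagonal a * _), hS,
      Matrix.transpose_mul, Matrix.transpose_transpose]
    simp only [Matrix.mul_assoc]
  rw [this, Matrix.trace]
  exact Finset.sum_congr rfl fun j _ => by rw [Matrix.diag_apply, Matrix.diagonal_mul]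

theorem proj_trace {n r : ℕ} {X : Matrix (Fin n) (Fin r) ℝ} (hX : Xᵀ * X = 1) :
    ∑ j, (X * Xᵀ) j j = r := by
  change (X * Xᵀ).trace = r
  rw [Matrix.trace_mul_comm, hX, Matrix.trace_one, Fintype.card_fin]

/-- The excess of a trace over the sum of the smallest eigenvalues. -/
theorem trace_sub_sum_ascEigenvalue {n r : ℕ} (hrn : r ≤ n) {S W : Matrix (Fin n) (Fin n) ℝ}
    (hS : S.IsHermitian) (hW : Wᵀ * W = 1) (hSW : S * W = W * diagonal (ascEigenvalue hS))
    {U : Matrix (Fin n) (Fin r) ℝ} (hU : U ∈ Stiefel n r) (μ : ℝ) :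
    (Uᵀ * S * U).trace - ∑ i : Fin r, ascEigenvalue hS (Fin.castLE hrn i) =
      ∑ j : Fin n, (ascEigenvalue hS j - μ) *
        (((Wᵀ * U) * (Wᵀ * U)ᵀ) j j - if (j : ℕ) < r then 1 else 0) := by
  have h1 := proj_trace (transpose_mul_stiefel hW hU)
  have h2 := sum_castLE_eq hrn (fun _ => (1 : ℝ))
  simp only [Finset.sum_const, Finset.card_univ, Fintype.card_fin, nsmul_eq_mul, mul_one] at h2
  have h3 : ∀ j : Fin n, (ascEigenvalue hS j - μ) *
        (((Wᵀ * U) * (Wᵀ * U)ᵀ) j j - if (j : ℕ) < r then 1 else 0) =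
      ascEigenvalue hS j * ((Wᵀ * U) * (Wᵀ * U)ᵀ) j j -
        (if (j : ℕ) < r then ascEigenvalue hS j else 0) -
        μ * ((Wᵀ * U) * (Wᵀ * U)ᵀ) j j + μ * (if (j : ℕ) < r then 1 else 0) := by
    intro j; split_ifs <;> ring
  rw [Finset.sum_congr rfl fun j _ => h3 j, Finset.sum_add_distrib, Finset.sum_sub_distrib,
    Finset.sum_sub_distrib, ← Finset.mul_sum, ← Finset.mul_sum, h1, ← h2,
    ← trace_eq_sum_mul_proj hW hSW, sum_castLE_eq hrn (ascEigenvalue hS)]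
  ring

theorem excess_term_nonneg {n r : ℕ} (hr : 0 < r) (hrn : r ≤ n) {S W : Matrix (Fin n) (Fin n) ℝ}
    (hS : S.IsHermitian) (hW : Wᵀ * W = 1) {U : Matrix (Fin n) (Fin r) ℝ} (hU : U ∈ Stiefel n r)
    (j : Fin n) :
    0 ≤ (ascEigenvalue hS j - ascEigenvalue hS ⟨r - 1, by omega⟩) *
        (((Wᵀ * U) * (Wᵀ * U)ᵀ) j j - if (j : ℕ) < r then 1 else 0) := by
  have hX := transpose_mul_stiefel hW hU
  split_ifs with hj
  · refine mul_nonneg_of_nonpos_of_nonpos (sub_nonpos.2 (ascEigenvalue_monotone hS ?_))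
      (sub_nonpos.2 (proj_diag_le_one hX j))
    rw [Fin.le_def]; simp; omega
  · rw [sub_zero]
    refine mul_nonneg (sub_nonneg.2 (ascEigenvalue_monotone hS ?_)) (proj_diag_nonneg hX j)
    rw [Fin.le_def]; simp; omega

/-- Ky Fan's minimum principle. -/
theorem sum_ascEigenvalue_le_trace {n r : ℕ} (hr : 0 < r) (hrn : r ≤ n)
    {S : Matrix (Fin n) (Fin n) ℝ} (hS : S.IsHermitian) {U : Matrix (Fin n) (Fin r) ℝ}
    (hU : U ∈ Stiefel n r) :
    ∑ i : Fin r, ascEigenvalue hS (Fin.castLE hrn i) ≤ (Uᵀ * S * U).trace := by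
  obtain ⟨W, hW, hSW⟩ := exists_orthogonal_mul_eq hS
  rw [← sub_nonneg, trace_sub_sum_ascEigenvalue hrn hS hW hSW hU]
  exact Finset.sum_nonneg fun j _ => excess_term_nonneg hr hrn hS hW hU j

theorem trace_of_mul_eq {n r : ℕ} {S : Matrix (Fin n) (Fin n) ℝ} {V : Matrix (Fin n) (Fin r) ℝ}
    (hV : V ∈ Stiefel n r) {b : Fin r → ℝ} (hSV : S * V = V * diagonal b) :
    (Vᵀ * S * V).trace = ∑ i, b i := by
  have hV' : Vᵀ * V = 1 := hV
  rw [Matrix.mul_assoc, hSV, ← Matrix.mul_assoc, hV', Matrix.one_mul, Matrix.trace_diagonal]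

/-- The equality case of Ky Fan's minimum principle. -/
theorem exists_isSmallestEigenvectors_of_trace_le {n r : ℕ} (hr : 0 < r) (hrn : r ≤ n)
    {S : Matrix (Fin n) (Fin n) ℝ} (hS : S.IsHermitian) {U : Matrix (Fin n) (Fin r) ℝ}
    (hU : U ∈ Stiefel n r)
    (hle : (Uᵀ * S * U).trace ≤ ∑ i : Fin r, ascEigenvalue hS (Fin.castLE hrn i)) :
    ∃ R : Matrix (Fin r) (Fin r) ℝ, Rᵀ * R = 1 ∧ IsSmallestEigenvectors hrn hS (U * R) := by
  obtain ⟨W, hW, hSW⟩ := exists_orthogonal_mul_eq hS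
  have hX := transpose_mul_stiefel hW hU
  set X := Wᵀ * U with hXdef
  set a := ascEigenvalue hS with ha
  have hUX : U = W * X := by
    rw [hXdef, ← Matrix.mul_assoc, mul_eq_one_comm.1 hW, Matrix.one_mul]
  set μ := a ⟨r - 1, by omega⟩ with hμ
  have hsum := trace_sub_sum_ascEigenvalue hrn hS hW hSW hU μ
  have hnn := fun j => excess_term_nonneg hr hrn hS hW hU j
  have hz : ∀ j, (a j - μ) * ((X * Xᵀ) j j - if (j : ℕ) < r then 1 else 0) = 0 := by
    have h0 := (Finset.sum_eq_zero_iff_of_nonneg fun j _ => hnn j).1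
      (le_antisymm (by rw [← hsum]; linarith) (Finset.sum_nonneg fun j _ => hnn j))
    exact fun j => h0 j (Finset.mem_univ j)
  have hoff : ∀ j k, j ≠ k → (a j - μ) * (X * Xᵀ) j k = 0 := by
    intro j k hjk
    rcases mul_eq_zero.1 (hz j) with h | h
    · rw [h, zero_mul]
    · rw [proj_apply_eq_zero hX ?_ hjk, mul_zero]
      split_ifs at h
      · right; linarith
      · left; linarith
  have hsymm : ∀ j k, (X * Xᵀ) j k = (X * Xᵀ) k j := by
    intro j k
    conv_lhs => rw [← Matrix.transpose_transpose X, ← Matrix.transpose_mul,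
      Matrix.transpose_transpose]
    rfl
  have hcomm : diagonal a * (X * Xᵀ) = (X * Xᵀ) * diagonal a := by
    ext j k
    rw [Matrix.diagonal_mul, Matrix.mul_diagonal]
    by_cases hjk : j = k
    · subst hjk; ring
    · have h1 := hoff j k hjk
      have h2 := hoff k j (Ne.symm hjk)
      rw [hsymm k j] at h2
      linarith
  set T := Xᵀ * diagonal a * X with hT
  have hXT : diagonal a * X = X * T := by
    calc diagonal a * X = diagonal a * (X * Xᵀ) * X := by
          rw [Matrix.mul_assoc, Matrix.mul_assoc, hX, Matrix.mul_one]
      _ = X * T := by rw [hcomm, hT]; simp only [Matrix.mul_assoc]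
  have hSU : S * U = U * T := by
    calc S * U = S * W * X := by rw [Matrix.mul_assoc, ← hUX]
      _ = U * T := by rw [hSW, Matrix.mul_assoc, hXT, ← Matrix.mul_assoc, ← hUX]
  have hTh : T.IsHermitian := by
    rw [Matrix.IsHermitian, Matrix.conjTranspose_eq_transpose_of_trivial, hT]
    simp [Matrix.transpose_mul, Matrix.mul_assoc]
  obtain ⟨R, hR, hTR⟩ := exists_orthogonal_mul_eq hTh
  have hV := mul_mem_stiefel hU hR
  have hSV : S * (U * R) = (U * R) * diagonal (ascEigenvalue hTh) := by
    rw [← Matrix.mul_assoc, hSU, Matrix.mul_assoc, hTR, Matrix.mul_assoc]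
  have hge := ascEigenvalue_le_of_mul_eq hrn hS hV (ascEigenvalue_monotone hTh) hSV
  have htr : ∑ i, ascEigenvalue hTh i ≤ ∑ i : Fin r, a (Fin.castLE hrn i) := by
    rw [← trace_of_mul_eq hV hSV, trace_of_mul_orthogonal U hR]
    exact hle
  have heq : ∀ i, a (Fin.castLE hrn i) = ascEigenvalue hTh i := fun i =>
    (Finset.sum_eq_sum_iff_of_le fun i _ => hge i).1
      (le_antisymm (Finset.sum_le_sum fun i _ => hge i) htr) i (Finset.mem_univ i)
  refine ⟨R, hR, hV, ?_⟩
  rw [hSV]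
  congr 2
  funext i
  exact (heq i).symm

theorem IsSmallestEigenvectors.trace_eq {n r : ℕ} {hrn : r ≤ n} {S : Matrix (Fin n) (Fin n) ℝ}
    {hS : S.IsHermitian} {V : Matrix (Fin n) (Fin r) ℝ} (hV : IsSmallestEigenvectors hrn hS V) :
    (Vᵀ * S * V).trace = ∑ i : Fin r, ascEigenvalue hS (Fin.castLE hrn i) :=
  trace_of_mul_eq hV.1 hV.2

theorem exists_isSmallestEigenvectors {n r : ℕ} (hrn : r ≤ n) {S : Matrix (Fin n) (Fin n) ℝ}
    (hS : S.IsHermitian) : ∃ V, IsSmallestEigenvectors hrn hS V := by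
  obtain ⟨W, hW, hSW⟩ := exists_orthogonal_mul_eq hS
  refine ⟨W.submatrix id (Fin.castLE hrn), ?_, ?_⟩
  · change (W.submatrix id (Fin.castLE hrn))ᵀ * W.submatrix id (Fin.castLE hrn) = 1
    ext i j
    have := congrFun (congrFun hW (Fin.castLE hrn i)) (Fin.castLE hrn j)
    simpa [Matrix.mul_apply, Matrix.one_apply] using this
  · ext i j
    have := congrFun (congrFun hSW i) (Fin.castLE hrn j)
    rw [Matrix.mul_diagonal] at this ⊢
    exact this

/-- If the columns of `U` and `V` are orthonormal and `U = V M`, then `M` is orthogonal. -/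
theorem orthogonal_of_eq_mul {n r : ℕ} {U V : Matrix (Fin n) (Fin r) ℝ} (hU : U ∈ Stiefel n r)
    (hV : V ∈ Stiefel n r) {M : Matrix (Fin r) (Fin r) ℝ} (h : U = V * M) : Mᵀ * M = 1 := by
  have hU' : Uᵀ * U = 1 := hU
  have hV' : Vᵀ * V = 1 := hV
  rwa [h, Matrix.transpose_mul, Matrix.mul_assoc, ← Matrix.mul_assoc Vᵀ, hV',
    Matrix.one_mul] at hU'

theorem tracePoint_eq_of_eq_mul {n r : ℕ} {U V : Matrix (Fin n) (Fin r) ℝ} (hU : U ∈ Stiefel n r)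
    (hV : V ∈ Stiefel n r) {M : Matrix (Fin r) (Fin r) ℝ} (h : U = V * M)
    (S T : Matrix (Fin n) (Fin n) ℝ) : tracePoint S T U = tracePoint S T V := by
  have hM := orthogonal_of_eq_mul hU hV h
  rw [tracePoint, tracePoint, h, trace_of_mul_orthogonal V hM, trace_of_mul_orthogonal V hM]

theorem range_mulVecLin_mul_orthogonal {n r : ℕ} (U : Matrix (Fin n) (Fin r) ℝ)
    {R : Matrix (Fin r) (Fin r) ℝ} (hR : Rᵀ * R = 1) :
    LinearMap.range U.mulVecLin = LinearMap.range (U * R).mulVecLin := by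
  apply le_antisymm
  · rintro _ ⟨x, rfl⟩
    refine ⟨Rᵀ *ᵥ x, ?_⟩
    simp [Matrix.mulVec_mulVec, mul_eq_one_comm.1 hR]
  · rintro _ ⟨x, rfl⟩
    exact ⟨R *ᵥ x, by simp⟩

theorem exists_eq_mul_of_range_le {n r : ℕ} {U V : Matrix (Fin n) (Fin r) ℝ}
    (h : LinearMap.range U.mulVecLin ≤ LinearMap.range V.mulVecLin) :
    ∃ M : Matrix (Fin r) (Fin r) ℝ, U = V * M := by
  have hc : ∀ j, ∃ x : Fin r → ℝ, V *ᵥ x = fun i => U i j := by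
    intro j
    obtain ⟨x, hx⟩ := h ⟨Pi.single j 1, rfl⟩
    refine ⟨x, ?_⟩
    rw [Matrix.mulVecLin_apply, Matrix.mulVecLin_apply, Matrix.mulVec_single_one] at hx
    exact hx
  choose x hx using hc
  refine ⟨Matrix.of fun i j => x j i, ?_⟩
  ext i j
  exact (congrFun (hx j) i).symm

/-- With a gap, the span of the eigenvectors for the smallest eigenvalues is unique. -/
theorem IsSmallestEigenvectors.exists_eq_mul {n r : ℕ} {hrn : r ≤ n}
    {S : Matrix (Fin n) (Fin n) ℝ} {hS : S.IsHermitian} (hgap : HasGap r hS) :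
    ∃ V₀ : Matrix (Fin n) (Fin r) ℝ, V₀ ∈ Stiefel n r ∧
      ∀ V, IsSmallestEigenvectors hrn hS V → ∃ M : Matrix (Fin r) (Fin r) ℝ, V = V₀ * M := by
  obtain ⟨W, hW, hSW⟩ := exists_orthogonal_mul_eq hS
  refine ⟨W.submatrix id (Fin.castLE hrn), ?_, fun V hV =>
    ⟨(Wᵀ * V).submatrix (Fin.castLE hrn) id, ?_⟩⟩
  · change (W.submatrix id (Fin.castLE hrn))ᵀ * W.submatrix id (Fin.castLE hrn) = 1
    ext i j
    have := congrFun (congrFun hW (Fin.castLE hrn i)) (Fin.castLE hrn j)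
    simpa [Matrix.mul_apply, Matrix.one_apply] using this
  · have hz : ∀ (j : Fin n) (l : Fin r), ¬ (j : ℕ) < r → (Wᵀ * V) j l = 0 := by
      intro j l hj
      have h := diagonal_mul_apply_eq hSW (by simpa using hS.eq) hV.2 j l
      have hlt : r < n := by omega
      have h1 : ascEigenvalue hS ⟨r, hlt⟩ ≤ ascEigenvalue hS j :=
        ascEigenvalue_monotone hS (by rw [Fin.le_def]; simp; omega)
      have h2 : ascEigenvalue hS (Fin.castLE hrn l) ≤ ascEigenvalue hS ⟨r - 1, by omega⟩ :=
        ascEigenvalue_monotone hS (by rw [Fin.le_def]; simp; omega)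
      have h3 := hgap hlt
      by_contra h0
      rw [mul_comm] at h
      have := mul_left_cancel₀ h0 h
      linarith
    have hVW : V = W * (Wᵀ * V) := by
      rw [← Matrix.mul_assoc, mul_eq_one_comm.1 hW, Matrix.one_mul]
    ext i l
    conv_lhs => rw [hVW]
    rw [Matrix.mul_apply (M := W.submatrix id (Fin.castLE hrn)), Matrix.mul_apply (M := W)]
    simp only [Matrix.submatrix_apply, id]
    rw [sum_castLE_eq hrn (fun j => W i j * (Wᵀ * V) j l)]
    refine Finset.sum_congr rfl fun j _ => ?_
    split_ifs with hj
    · rfl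
    · rw [hz j l hj, mul_zero]

open Filter Topology

theorem exists_diagonal_add_det_ne_zero {r : ℕ} (M : Matrix (Fin r) (Fin r) ℝ)
    (s : Finset (Fin r)) :
    ∃ d : Fin r → ℝ, (∀ i ∈ s, d i = 1 ∨ d i = -1) ∧ (diagonal d + M).det ≠ 0 := by
  induction s using Finset.induction_on with
  | empty =>
    obtain ⟨x, hx⟩ := Infinite.exists_notMem_finset (-M).charpoly.roots.toFinset
    refine ⟨fun _ => x, by simp, ?_⟩
    intro h
    apply hx
    rw [Multiset.mem_toFinset, Polynomial.mem_roots (Matrix.charpoly_monic _).ne_zero,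
      Polynomial.IsRoot, Matrix.eval_charpoly, ← h]
    simp [Matrix.scalar_apply]
  | insert i s hi ih =>
    obtain ⟨d, hd, hdet⟩ := ih
    have key : ∀ x, (diagonal (Function.update d i x) + M).det =
        (diagonal d + M).det + (x - d i) *
          ((diagonal d + M).updateRow i (Pi.single i 1)).det := by
      intro x
      have h : diagonal (Function.update d i x) + M =
          (diagonal d + M).updateRow i ((diagonal d + M) i + (x - d i) • Pi.single i 1) := by
        ext j k
        by_cases hj : j = i
        · subst hj
          by_cases hk : k = j
          · subst hk; simp; ring
          · simp [hk, Ne.symm hk]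
        · by_cases hk : j = k
          · subst hk; simp [hj]
          · simp [hj, hk]
      rw [h, det_updateRow_add, det_updateRow_smul, updateRow_eq_self]
    have hne : ∃ x : ℝ, (x = 1 ∨ x = -1) ∧ (diagonal (Function.update d i x) + M).det ≠ 0 := by
      by_contra! hcon
      have h1 := hcon 1 (Or.inl rfl)
      have h2 := hcon (-1) (Or.inr rfl)
      rw [key] at h1 h2
      have h3 : ((diagonal d + M).updateRow i (Pi.single i 1)).det = 0 := by linarith
      rw [h3, mul_zero, add_zero] at h1
      exact hdet h1
    obtain ⟨x, hx, hxdet⟩ := hne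
    refine ⟨Function.update d i x, fun j hj => ?_, hxdet⟩
    rcases Finset.mem_insert.1 hj with rfl | hj'
    · simpa using hx
    · rw [Function.update_of_ne (by rintro rfl; exact hi hj')]
      exact hd j hj'

/-- A full-rank matrix can be orthonormalized by a column operation. -/
theorem exists_orthonormalization {n r : ℕ} {Z : Matrix (Fin n) (Fin r) ℝ}
    (hZ : (Zᵀ * Z).det ≠ 0) :
    ∃ R : Matrix (Fin r) (Fin r) ℝ, Z * R ∈ Stiefel n r ∧ R * Rᵀ = (Zᵀ * Z)⁻¹ := by
  have hK : (Zᵀ * Z).PosSemidef := by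
    simpa using Matrix.posSemidef_conjTranspose_mul_self Z
  obtain ⟨B, hB⟩ : ∃ B : Matrix (Fin r) (Fin r) ℝ, (Zᵀ * Z)⁻¹ = Bᵀ * B := by
    open scoped MatrixOrder in
    obtain ⟨B, hB⟩ := CStarAlgebra.nonneg_iff_eq_star_mul_self.mp hK.inv.nonneg
    exact ⟨B, by simpa [Matrix.star_eq_conjTranspose] using hB⟩
  refine ⟨Bᵀ, ?_, by rw [Matrix.transpose_transpose, hB]⟩
  change (Z * Bᵀ)ᵀ * (Z * Bᵀ) = 1
  have h : Bᵀ * (B * (Zᵀ * Z)) = 1 := by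
    rw [← Matrix.mul_assoc, ← hB, Matrix.nonsing_inv_mul _ (isUnit_iff_ne_zero.2 hZ)]
  rw [Matrix.transpose_mul, Matrix.transpose_transpose, ← mul_eq_one_comm.1 h]
  simp only [Matrix.mul_assoc]

theorem combination_det_ne_zero {n r : ℕ} {V₀ V₁ : Matrix (Fin n) (Fin r) ℝ}
    (h₀ : V₀ ∈ Stiefel n r) (h₁ : V₁ ∈ Stiefel n r) (hdet : (1 + V₀ᵀ * V₁).det ≠ 0) (s : ℝ) :
    (((1 - s) • V₀ + s • V₁)ᵀ * ((1 - s) • V₀ + s • V₁)).det ≠ 0 := by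
  have h₀' : V₀ᵀ * V₀ = 1 := h₀
  have h₁' : V₁ᵀ * V₁ = 1 := h₁
  intro h
  obtain ⟨x, hx, hx0⟩ := Matrix.exists_mulVec_eq_zero_iff.2 h
  have hZ : ((1 - s) • V₀ + s • V₁) *ᵥ x = 0 := by
    have := (Matrix.conjTranspose_mul_self_mulVec_eq_zero ((1 - s) • V₀ + s • V₁) x).1
    rw [Matrix.conjTranspose_eq_transpose_of_trivial] at this
    exact this hx0
  have e0 : (1 - s) • x + s • ((V₀ᵀ * V₁) *ᵥ x) = 0 := by
    have := congrArg (V₀ᵀ *ᵥ ·) hZ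
    simpa [Matrix.mulVec_add, Matrix.mulVec_smul, Matrix.mulVec_mulVec, Matrix.add_mulVec, h₀',
      Matrix.smul_mulVec] using this
  have e1 : (1 - s) • ((V₁ᵀ * V₀) *ᵥ x) + s • x = 0 := by
    have := congrArg (V₁ᵀ *ᵥ ·) hZ
    simpa [Matrix.mulVec_add, Matrix.mulVec_smul, Matrix.mulVec_mulVec, Matrix.add_mulVec, h₁',
      Matrix.smul_mulVec] using this
  have hsym : x ⬝ᵥ ((V₁ᵀ * V₀) *ᵥ x) = x ⬝ᵥ ((V₀ᵀ * V₁) *ᵥ x) := by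
    rw [Matrix.dotProduct_mulVec, ← Matrix.mulVec_transpose, Matrix.transpose_mul,
      Matrix.transpose_transpose, dotProduct_comm]
  have d0 := congrArg (x ⬝ᵥ ·) e0
  have d1 := congrArg (x ⬝ᵥ ·) e1
  simp only [dotProduct_add, dotProduct_smul, smul_eq_mul, dotProduct_zero, hsym] at d0 d1
  have hxx : 0 < x ⬝ᵥ x := by
    refine lt_of_le_of_ne (Finset.sum_nonneg fun i _ => mul_self_nonneg (x i)) fun h => hx ?_
    exact dotProduct_self_eq_zero.1 h.symm
  have hs : s = 1 / 2 := by
    have : (1 - 2 * s) * (x ⬝ᵥ x) = 0 := by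
      linear_combination (1 - s) * d0 - s * d1
    rcases mul_eq_zero.1 this with h | h
    · linarith
    · exact absurd h hxx.ne'
  apply hdet
  refine Matrix.exists_mulVec_eq_zero_iff.1 ⟨x, hx, ?_⟩
  rw [hs] at e0
  rw [Matrix.add_mulVec, Matrix.one_mulVec]
  have := congrArg ((2 : ℝ) • ·) e0
  simp only [smul_add, smul_smul, smul_zero] at this
  norm_num at this
  exact this

/-- The values of a trace on the minimizing frames of `S` form an interval. -/
theorem exists_trace_eq_zero_of_isSmallestEigenvectors {n r : ℕ} {hrn : r ≤ n}
    {S : Matrix (Fin n) (Fin n) ℝ} {hS : S.IsHermitian} (G : Matrix (Fin n) (Fin n) ℝ)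
    {V₀ V₁ : Matrix (Fin n) (Fin r) ℝ} (h₀ : IsSmallestEigenvectors hrn hS V₀)
    (h₁ : IsSmallestEigenvectors hrn hS V₁) (hG₀ : (V₀ᵀ * G * V₀).trace ≤ 0)
    (hG₁ : 0 ≤ (V₁ᵀ * G * V₁).trace) :
    ∃ U ∈ Stiefel n r, (Uᵀ * S * U).trace = ∑ i : Fin r, ascEigenvalue hS (Fin.castLE hrn i) ∧
      (Uᵀ * G * U).trace = 0 := by
  obtain ⟨d, hd, hdet⟩ := exists_diagonal_add_det_ne_zero (V₀ᵀ * V₁) Finset.univ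
  have hdd : diagonal d * diagonal d = 1 := by
    rw [Matrix.diagonal_mul_diagonal, ← Matrix.diagonal_one]
    congr 1
    funext i
    rcases hd i (Finset.mem_univ i) with h | h <;> simp [h]
  have hdo : (diagonal d)ᵀ * diagonal d = 1 := by rw [Matrix.diagonal_transpose, hdd]
  set Λ := diagonal fun i : Fin r => ascEigenvalue hS (Fin.castLE hrn i) with hΛ
  set V₂ := V₁ * diagonal d with hV₂
  have h₂ : V₂ ∈ Stiefel n r := mul_mem_stiefel h₁.1 hdo
  have hSV₂ : S * V₂ = V₂ * Λ := by
    rw [hV₂, ← Matrix.mul_assoc, h₁.2, Matrix.mul_assoc, Matrix.mul_assoc,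
      Matrix.diagonal_mul_diagonal, hΛ, Matrix.diagonal_mul_diagonal]
    congr 2
    funext i
    ring
  have hdet₂ : (1 + V₀ᵀ * V₂).det ≠ 0 := by
    have : 1 + V₀ᵀ * V₂ = (diagonal d + V₀ᵀ * V₁) * diagonal d := by
      rw [Matrix.add_mul, hdd, hV₂, Matrix.mul_assoc]
    rw [this, Matrix.det_mul]
    refine mul_ne_zero hdet fun h => ?_
    have := congrArg Matrix.det hdd
    rw [Matrix.det_mul, h, zero_mul, Matrix.det_one] at this
    exact zero_ne_one this
  have hK := combination_det_ne_zero h₀.1 h₂ hdet₂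
  let Z : ℝ → Matrix (Fin n) (Fin r) ℝ := fun s => (1 - s) • V₀ + s • V₂
  have hZ : Continuous Z := by fun_prop
  have hSZ : ∀ s, S * Z s = Z s * Λ := by
    intro s
    simp only [Z, Matrix.mul_add, Matrix.add_mul, Matrix.mul_smul, Matrix.smul_mul, hSV₂, h₀.2, hΛ]
  let f : ℝ → ℝ := fun s => (((Z s)ᵀ * Z s)⁻¹ * ((Z s)ᵀ * G * Z s)).trace
  have hf : Continuous f := by
    have hK' : Continuous fun s => (Z s)ᵀ * Z s := hZ.matrix_transpose.matrix_mul hZ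
    have hI : Continuous fun s => ((Z s)ᵀ * Z s)⁻¹ := by
      simp only [Matrix.inv_def, Ring.inverse_eq_inv']
      exact (hK'.matrix_det.inv₀ hK).smul hK'.matrix_adjugate
    exact (hI.matrix_mul ((hZ.matrix_transpose.matrix_mul continuous_const).matrix_mul
      hZ)).matrix_trace
  have hf0 : f 0 ≤ 0 := by
    have : V₀ᵀ * V₀ = 1 := h₀.1
    simpa [f, Z, this] using hG₀
  have hf1 : 0 ≤ f 1 := by
    have : V₂ᵀ * V₂ = 1 := h₂
    have hG₂ : 0 ≤ (V₂ᵀ * G * V₂).trace := by rwa [hV₂, trace_of_mul_orthogonal V₁ hdo G]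
    simpa [f, Z, this] using hG₂
  obtain ⟨s, -, hs⟩ := intermediate_value_Icc zero_le_one hf.continuousOn ⟨hf0, hf1⟩
  obtain ⟨R, hU, hR⟩ := exists_orthonormalization (hK s)
  change Z s * R ∈ Stiefel n r at hU
  change R * Rᵀ = ((Z s)ᵀ * Z s)⁻¹ at hR
  refine ⟨Z s * R, hU, ?_, ?_⟩
  · rw [trace_transpose_mul_mul_mul, hR, Matrix.mul_assoc, hSZ, ← Matrix.mul_assoc (Z s)ᵀ,
      ← Matrix.mul_assoc, Matrix.nonsing_inv_mul _ (isUnit_iff_ne_zero.2 (hK s)), Matrix.one_mul,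
      hΛ, Matrix.trace_diagonal]
  · rw [trace_transpose_mul_mul_mul, hR]
    exact hs

theorem isCompact_stiefel (n r : ℕ) : IsCompact (Stiefel n r) := by
  have hb : IsCompact (Set.univ.pi fun _ : Fin n => Set.univ.pi fun _ : Fin r =>
      Set.Icc (-1 : ℝ) 1) :=
    isCompact_univ_pi fun _ => isCompact_univ_pi fun _ => isCompact_Icc
  refine hb.of_isClosed_subset ?_ ?_
  · exact isClosed_eq (continuous_id.matrix_transpose.matrix_mul continuous_id) continuous_const
  · intro (U : Matrix (Fin n) (Fin r) ℝ) hU i _ j _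
    have hU' : Uᵀ * U = 1 := hU
    have h : U i j ^ 2 ≤ 1 := by
      rw [← col_sum_sq hU' j]
      exact Finset.single_le_sum (f := fun i => U i j ^ 2) (fun _ _ => sq_nonneg _)
        (Finset.mem_univ i)
    exact abs_le.1 ((sq_le_one_iff_abs_le_one _).1 h)

section Pencil

variable {m₁ m₂ n r : ℕ} (hr : 0 < r) (hrn : r ≤ n) (A : Matrix (Fin m₁) (Fin n) ℝ)
  (B : Matrix (Fin m₂) (Fin n) ℝ)

theorem trace_pencil (t : ℝ) (U : Matrix (Fin n) (Fin r) ℝ) :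
    (Uᵀ * pencil r A B t * U).trace =
      t * (tracePoint (lossMatrix r A) (lossMatrix r B) U).1 +
        (1 - t) * (tracePoint (lossMatrix r A) (lossMatrix r B) U).2 := by
  simp [pencil, tracePoint, Matrix.mul_add, Matrix.add_mul]

theorem trace_lossMatrix_sub (U : Matrix (Fin n) (Fin r) ℝ) :
    (Uᵀ * (lossMatrix r A - lossMatrix r B) * U).trace =
      (tracePoint (lossMatrix r A) (lossMatrix r B) U).1 -
        (tracePoint (lossMatrix r A) (lossMatrix r B) U).2 := by
  simp [tracePoint, Matrix.mul_sub, Matrix.sub_mul]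

theorem continuous_tracePoint (S T : Matrix (Fin n) (Fin n) ℝ) :
    Continuous (tracePoint S T : Matrix (Fin n) (Fin r) ℝ → ℝ × ℝ) := by
  have h : ∀ S : Matrix (Fin n) (Fin n) ℝ,
      Continuous fun U : Matrix (Fin n) (Fin r) ℝ => (Uᵀ * S * U).trace := fun S =>
    ((continuous_id.matrix_transpose.matrix_mul continuous_const).matrix_mul
      continuous_id).matrix_trace
  exact (h S).prodMk (h T)

include hr in
theorem phi_le {U : Matrix (Fin n) (Fin r) ℝ} (hU : U ∈ Stiefel n r) (t : ℝ) :
    phi hrn A B t ≤ t * (tracePoint (lossMatrix r A) (lossMatrix r B) U).1 +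
        (1 - t) * (tracePoint (lossMatrix r A) (lossMatrix r B) U).2 := by
  rw [← trace_pencil]
  exact sum_ascEigenvalue_le_trace hr hrn _ hU

include hr in
theorem continuous_phi : Continuous (phi hrn A B) := by
  obtain ⟨C, hC⟩ := (isCompact_stiefel n r).exists_bound_of_continuousOn
    (f := fun U : Matrix (Fin n) (Fin r) ℝ =>
      (tracePoint (lossMatrix r A) (lossMatrix r B) U).1 -
        (tracePoint (lossMatrix r A) (lossMatrix r B) U).2)
    (((continuous_tracePoint _ _).fst.sub (continuous_tracePoint _ _).snd).continuousOn)
  have key : ∀ t s, phi hrn A B t ≤ phi hrn A B s + C * dist t s := by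
    intro t s
    obtain ⟨V, hV⟩ := exists_isSmallestEigenvectors hrn (pencil_isHermitian r A B s)
    have h1 := phi_le hr hrn A B hV.1 t
    have h2 : phi hrn A B s = _ := hV.trace_eq.symm
    rw [trace_pencil] at h2
    have h3 := hC V hV.1
    rw [Real.norm_eq_abs] at h3
    have h4 := mul_le_mul_of_nonneg_right h3 (abs_nonneg (t - s))
    rw [← abs_mul] at h4
    have h5 := le_abs_self (((tracePoint (lossMatrix r A) (lossMatrix r B) V).1 -
        (tracePoint (lossMatrix r A) (lossMatrix r B) V).2) * (t - s))
    rw [Real.dist_eq]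
    linarith
  exact (LipschitzWith.of_le_add_mul C.toNNReal fun t s => (key t s).trans <| by
    gcongr
    exact Real.le_coe_toNNReal C).continuous

include hr in
/-- One-sided first-order condition at a maximizer of `φ`. -/
theorem exists_isSmallestEigenvectors_slope_le {t : ℝ} (ht : t ∈ Icc (0 : ℝ) 1)
    (hmax : IsMaxOn (phi hrn A B) (Icc (0 : ℝ) 1) t) {τ : ℝ} (hτ : τ ∈ Icc (0 : ℝ) 1) :
    ∃ V, IsSmallestEigenvectors hrn (pencil_isHermitian r A B t) V ∧
      (τ - t) * ((tracePoint (lossMatrix r A) (lossMatrix r B) V).1 -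
        (tracePoint (lossMatrix r A) (lossMatrix r B) V).2) ≤ 0 := by
  let δ : ℕ → ℝ := fun k => 1 / ((k : ℝ) + 1)
  have hδ0 : ∀ k, 0 < δ k := fun k => by positivity
  have hδ1 : ∀ k, δ k ≤ 1 := fun k => by
    rw [div_le_one (by positivity)]; linarith [(Nat.cast_nonneg k : (0 : ℝ) ≤ k)]
  choose V hV using fun k =>
    exists_isSmallestEigenvectors hrn (pencil_isHermitian r A B (t + δ k * (τ - t)))
  have : FirstCountableTopology (Matrix (Fin n) (Fin r) ℝ) :=
    inferInstanceAs (FirstCountableTopology (Fin n → Fin r → ℝ))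
  obtain ⟨U, hU, ψ, hψ, hlim⟩ := (isCompact_stiefel n r).tendsto_subseq fun k => (hV k).1
  have hδlim : Tendsto (fun k => δ (ψ k)) atTop (𝓝 0) :=
    tendsto_one_div_add_atTop_nhds_zero_nat.comp hψ.tendsto_atTop
  have hy := (continuous_tracePoint (lossMatrix r A) (lossMatrix r B)).tendsto U |>.comp hlim
  have hy1 := hy.fst_nhds
  have hy2 := hy.snd_nhds
  have hval : ∀ k, phi hrn A B (t + δ k * (τ - t)) = _ := fun k => (hV k).trace_eq.symm
  have hle : ∀ k, phi hrn A B (t + δ k * (τ - t)) ≤ phi hrn A B t := by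
    intro k
    refine hmax ⟨?_, ?_⟩
    · nlinarith [hδ0 k, hδ1 k, ht.1, hτ.1, mul_nonneg (hδ0 k).le hτ.1,
        mul_nonneg (sub_nonneg.2 (hδ1 k)) ht.1]
    · nlinarith [mul_nonneg (hδ0 k).le (sub_nonneg.2 hτ.2),
        mul_nonneg (sub_nonneg.2 (hδ1 k)) (sub_nonneg.2 ht.2)]
  have hslope : (τ - t) * ((tracePoint (lossMatrix r A) (lossMatrix r B) U).1 -
      (tracePoint (lossMatrix r A) (lossMatrix r B) U).2) ≤ 0 := by
    refine le_of_tendsto ((hy1.sub hy2).const_mul (τ - t)) (Eventually.of_forall fun k => ?_)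
    have h1 := hle (ψ k)
    rw [hval, trace_pencil] at h1
    have h2 := phi_le hr hrn A B (hV (ψ k)).1 t
    have h3 := hδ0 (ψ k)
    simp only [Function.comp_apply]
    by_contra! hpos
    have := mul_pos h3 hpos
    nlinarith
  have htr : (Uᵀ * pencil r A B t * U).trace ≤ phi hrn A B t := by
    rw [trace_pencil]
    have hp : Tendsto (fun k => t + δ (ψ k) * (τ - t)) atTop (𝓝 t) := by
      simpa using (hδlim.mul_const (τ - t)).const_add t
    refine le_of_tendsto ((hp.mul hy1).add ((hp.const_sub 1).mul hy2))
      (Eventually.of_forall fun k => ?_)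
    have h1 := hle (ψ k)
    rw [hval, trace_pencil] at h1
    exact h1
  obtain ⟨R, hR, hUR⟩ := exists_isSmallestEigenvectors_of_trace_le hr hrn
    (pencil_isHermitian r A B t) hU htr
  refine ⟨U * R, hUR, ?_⟩
  rwa [tracePoint_eq_of_eq_mul hUR.1 hU rfl]

include hr in
/-- Every maximizer of `φ` has a minimizing frame whose two traces are at most `φ(t)`. -/
theorem exists_max_tracePoint_le {t : ℝ} (ht : t ∈ Icc (0 : ℝ) 1)
    (hmax : IsMaxOn (phi hrn A B) (Icc (0 : ℝ) 1) t) :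
    ∃ U ∈ Stiefel n r, max (tracePoint (lossMatrix r A) (lossMatrix r B) U).1
      (tracePoint (lossMatrix r A) (lossMatrix r B) U).2 ≤ phi hrn A B t := by
  obtain ⟨V₀, hV₀, hs₀⟩ := exists_isSmallestEigenvectors_slope_le hr hrn A B ht hmax
    (right_mem_Icc.2 zero_le_one)
  obtain ⟨V₁, hV₁, hs₁⟩ := exists_isSmallestEigenvectors_slope_le hr hrn A B ht hmax
    (left_mem_Icc.2 zero_le_one)
  have e₀ : phi hrn A B t = _ := hV₀.trace_eq.symm
  have e₁ : phi hrn A B t = _ := hV₁.trace_eq.symm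
  rw [trace_pencil] at e₀ e₁
  rcases eq_or_lt_of_le ht.1 with h0 | h0
  · subst h0
    refine ⟨V₀, hV₀.1, max_le ?_ ?_⟩ <;> linarith
  rcases eq_or_lt_of_le ht.2 with h1 | h1
  · subst h1
    refine ⟨V₁, hV₁.1, max_le ?_ ?_⟩ <;> linarith
  obtain ⟨U, hU, hUS, hUG⟩ := exists_trace_eq_zero_of_isSmallestEigenvectors
    (lossMatrix r A - lossMatrix r B) hV₀ hV₁
    (by rw [trace_lossMatrix_sub]; exact nonpos_of_mul_nonpos_right hs₀ (sub_pos.2 h1))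
    (by rw [trace_lossMatrix_sub]; nlinarith)
  rw [trace_lossMatrix_sub] at hUG
  rw [trace_pencil] at hUS
  change _ = phi hrn A B t at hUS
  have := sub_eq_zero.1 hUG
  rw [← this] at hUS
  exact ⟨U, hU, max_le (by linarith) (by linarith)⟩

include hr in
theorem phi_le_max {t : ℝ} (ht : t ∈ Icc (0 : ℝ) 1) {z : ℝ × ℝ}
    (hz : z ∈ jointNumericalRange r (lossMatrix r A) (lossMatrix r B)) :
    phi hrn A B t ≤ max z.1 z.2 := by
  obtain ⟨U, hU, rfl⟩ := hz
  refine (phi_le hr hrn A B hU t).trans ?_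
  set y := tracePoint (lossMatrix r A) (lossMatrix r B) U
  have h1 := mul_le_mul_of_nonneg_left (le_max_left y.1 y.2) ht.1
  have h2 := mul_le_mul_of_nonneg_left (le_max_right y.1 y.2) (sub_nonneg.2 ht.2)
  linarith

end Pencil

end FairPCA

theorem theorem4p1 {m₁ m₂ n r : ℕ} (hm₁ : 0 < m₁) (hm₂ : 0 < m₂) (hr : 0 < r) (hrn : r ≤ n)
    (A : Matrix (Fin m₁) (Fin n) ℝ) (B : Matrix (Fin m₂) (Fin n) ℝ) :
    -- both optima are attained, and they are equal
    (∃ v : ℝ,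
      IsLeast ((fun y : ℝ × ℝ => max y.1 y.2) ''
        FairPCA.jointNumericalRange r (FairPCA.lossMatrix r A) (FairPCA.lossMatrix r B)) v ∧
      IsGreatest (FairPCA.phi hrn A B '' Set.Icc (0 : ℝ) 1) v) ∧
    -- every optimal `y` and every maximizer `t` of `φ`
    (∀ t ∈ Set.Icc (0 : ℝ) 1, IsMaxOn (FairPCA.phi hrn A B) (Set.Icc (0 : ℝ) 1) t →
      ∀ y : ℝ × ℝ, FairPCA.IsOptimal r A B y →
        (∃ U : Matrix (Fin n) (Fin r) ℝ,
          FairPCA.IsSmallestEigenvectors hrn (FairPCA.pencil_isHermitian r A B t) U ∧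
          y = FairPCA.tracePoint (FairPCA.lossMatrix r A) (FairPCA.lossMatrix r B) U) ∧
        (∀ U ∈ FairPCA.Stiefel n r,
          y = FairPCA.tracePoint (FairPCA.lossMatrix r A) (FairPCA.lossMatrix r B) U →
          FairPCA.IsSmallestEigenspaceBasis hrn (FairPCA.pencil_isHermitian r A B t) U) ∧
        (FairPCA.HasGap r (FairPCA.pencil_isHermitian r A B t) →
          ∀ U : Matrix (Fin n) (Fin r) ℝ,
            FairPCA.IsSmallestEigenspaceBasis hrn (FairPCA.pencil_isHermitian r A B t) U →
            y = FairPCA.tracePoint (FairPCA.lossMatrix r A) (FairPCA.lossMatrix r B) U)) := by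
  open FairPCA in
  refine ⟨?_, fun t ht hmax y hy => ?_⟩
  · obtain ⟨t, ht, hmax⟩ := isCompact_Icc.exists_isMaxOn (nonempty_Icc.2 zero_le_one)
      (continuous_phi hr hrn A B).continuousOn
    obtain ⟨U, hU, hle⟩ := exists_max_tracePoint_le hr hrn A B ht hmax
    refine ⟨phi hrn A B t, ⟨⟨_, ⟨U, hU, rfl⟩, ?_⟩, ?_⟩, ⟨t, ht, rfl⟩, ?_⟩
    · exact le_antisymm hle (phi_le_max hr hrn A B ht ⟨U, hU, rfl⟩)
    · rintro _ ⟨z, hz, rfl⟩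
      exact phi_le_max hr hrn A B ht hz
    · rintro _ ⟨s, hs, rfl⟩
      exact hmax hs
  · have hmin : ∀ U ∈ Stiefel n r, y = tracePoint (lossMatrix r A) (lossMatrix r B) U →
        ∃ R : Matrix (Fin r) (Fin r) ℝ, Rᵀ * R = 1 ∧
          IsSmallestEigenvectors hrn (pencil_isHermitian r A B t) (U * R) := by
      intro U hU hyU
      refine exists_isSmallestEigenvectors_of_trace_le hr hrn _ hU ?_
      rw [trace_pencil, ← hyU]
      obtain ⟨V, hV, hle⟩ := exists_max_tracePoint_le hr hrn A B ht hmax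
      have h0 := (hy.2 _ ⟨V, hV, rfl⟩).trans hle
      have h1 := mul_le_mul_of_nonneg_left (le_max_left y.1 y.2) ht.1
      have h2 := mul_le_mul_of_nonneg_left (le_max_right y.1 y.2) (sub_nonneg.2 ht.2)
      change _ ≤ phi hrn A B t
      linarith
    have hex : ∃ U : Matrix (Fin n) (Fin r) ℝ,
        IsSmallestEigenvectors hrn (pencil_isHermitian r A B t) U ∧
        y = tracePoint (lossMatrix r A) (lossMatrix r B) U := by
      obtain ⟨U, hU, hyU⟩ := hy.1
      obtain ⟨R, hR, hUR⟩ := hmin U hU hyU.symm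
      exact ⟨U * R, hUR, by rw [tracePoint_eq_of_eq_mul hUR.1 hU rfl, hyU]⟩
    refine ⟨hex, fun U hU hyU => ?_, fun hgap U hU => ?_⟩
    · obtain ⟨R, hR, hUR⟩ := hmin U hU hyU
      exact ⟨hU, U * R, hUR, range_mulVecLin_mul_orthogonal U hR⟩
    · obtain ⟨U₀, hU₀, hyU₀⟩ := hex
      obtain ⟨hUS, V, hV, hrange⟩ := hU
      obtain ⟨V₀, hV₀, huniq⟩ := IsSmallestEigenvectors.exists_eq_mul (hrn := hrn) hgap
      obtain ⟨M, hM⟩ := exists_eq_mul_of_range_le hrange.le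
      obtain ⟨M₁, hM₁⟩ := huniq V hV
      obtain ⟨M₂, hM₂⟩ := huniq U₀ hU₀
      rw [hyU₀, tracePoint_eq_of_eq_mul hUS hV.1 hM, tracePoint_eq_of_eq_mul hV.1 hV₀ hM₁,
        tracePoint_eq_of_eq_mul hU₀.1 hV₀ hM₂]
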